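/- For a graph $X$ and an integer $m\ge 1$, let $mX$ be the multigraph obtained from $X$ by replacing each edge $\{x,y\}$ by $m$ parallel edges $\{x,y\}_0,\dots,\{x,y\}_{m-1}$; it has arcs $(x,y)_i$ for each arc $(x,y)$ of $X$ and each $0\le i<m$. Let $K(mX)$ be the simple graph whose vertices are the arcs of $mX$, in which any two distinct arcs emanating from the same vertex of $X$ are adjacent, $(x,y)_i$ is adjacent to $(y,x)_i$ for each edge $\{x,y\}_i$ of $mX$, and there are no other edges. A Hamilton decomposition of a $k$-valent graph is a set of $\lfloor k/2\rfloor$ pairwise edge-disjoint Hamilton cycles in it. Let $F10$ be the Petersen graph and $F28$ the Coxeter graph. For every integer $m\ge 1$: 1. $K(mF10)$ is a connected $3m$-valent vertex-transitive graph of order $30m$ that has no Hamilton decomposition; 2. $K(mF28)$ is a connected $3m$-valent vertex-transitive graph of order $84m$ that has no Hamilton decomposition. Consequently, there exist connected vertex-transitive graphs of arbitrarily large valency with no Hamilton decomposition: for every $N$ there are $k\ge N$ and a finite connected $k$-valent vertex-transitive graph that has no Hamilton decomposition. -/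

import Mathlib

namespace SimpleGraph

/-- The Petersen graph `F10`: its vertices are the `2`-subsets of a `5`-set, and two vertices
are adjacent exactly when they are disjoint. -/
def petersenGraph : SimpleGraph {s : Finset (Fin 5) // s.card = 2} where
  Adj s t := Disjoint s.1 t.1
  symm := ⟨fun _ _ h => h.symm⟩
  loopless := ⟨fun s h => by
    have h0 : s.1 = ∅ := disjoint_self.mp h
    have h1 := s.2
    rw [h0] at h1
    simp at h1⟩

instance : DecidableRel petersenGraph.Adj := fun s t =>
  inferInstanceAs (Decidable (Disjoint s.1 t.1))

/-- The Coxeter graph `F28`: its vertices are the `3`-subsets of the seven points of the Fano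
plane that are not lines, and two vertices are adjacent exactly when they are disjoint. The points
are the integers modulo `7`, and the lines are the seven sets `{i, i + 1, i + 3}`. -/
def coxeterGraph :
    SimpleGraph {s : Finset (Fin 7) // s.card = 3 ∧ ∀ i : Fin 7, s ≠ {i, i + 1, i + 3}} where
  Adj s t := Disjoint s.1 t.1
  symm := ⟨fun _ _ h => h.symm⟩
  loopless := ⟨fun s h => by
    have h0 : s.1 = ∅ := disjoint_self.mp h
    have h1 := s.2.1
    rw [h0] at h1
    simp at h1⟩

instance : DecidableRel coxeterGraph.Adj := fun s t =>
  inferInstanceAs (Decidable (Disjoint s.1 t.1))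

/-- The arcs of the multigraph `mX`, obtained from the graph `X` by replacing each edge by `m`
parallel edges: the pair `(a, i)` is the `i`-th copy of the arc `a` of `X`. -/
abbrev MultiArc {V : Type*} (X : SimpleGraph V) (m : ℕ) : Type _ := X.Dart × Fin m

/-- The graph `K(mX)`. Its vertices are the arcs of `mX`. Any two distinct arcs emanating from the
same vertex are adjacent, and for each edge `{x, y}_i` of `mX` the arcs `(x, y)_i` and `(y, x)_i`
are adjacent; there are no other edges. -/
def arcCliqueGraph {V : Type*} (X : SimpleGraph V) (m : ℕ) : SimpleGraph (X.MultiArc m) where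
  Adj a b := (a ≠ b ∧ a.1.fst = b.1.fst) ∨ (a.1 = b.1.symm ∧ a.2 = b.2)
  symm := ⟨by
    rintro a b (⟨h, h'⟩ | ⟨h, h'⟩)
    · exact Or.inl ⟨h.symm, h'.symm⟩
    · exact Or.inr ⟨by rw [h, Dart.symm_symm], h'.symm⟩⟩
  loopless := ⟨by
    rintro a (⟨h, -⟩ | ⟨h, -⟩)
    · exact h rfl
    · exact a.1.symm_ne h.symm⟩

instance {V : Type*} [DecidableEq V] (X : SimpleGraph V) (m : ℕ) :
    DecidableRel (X.arcCliqueGraph m).Adj := fun a b =>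
  inferInstanceAs (Decidable ((a ≠ b ∧ a.1.fst = b.1.fst) ∨ (a.1 = b.1.symm ∧ a.2 = b.2)))

/-- A graph is vertex-transitive if its automorphism group acts transitively on its vertices. -/
def IsVertexTransitive {V : Type*} (X : SimpleGraph V) : Prop :=
  ∀ v w : V, ∃ f : X ≃g X, f v = w

/-- For a `k`-valent graph `X`: there is a Hamilton decomposition of `X`, that is, a family of
`⌊k / 2⌋` pairwise edge-disjoint Hamilton cycles in `X`. -/
def HasHamiltonDecomposition {V : Type*} [DecidableEq V] (X : SimpleGraph V) (k : ℕ) : Prop :=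
  ∃ (base : Fin (k / 2) → V) (C : ∀ j, X.Walk (base j) (base j)),
    (∀ j, (C j).IsHamiltonianCycle) ∧
      ∀ i j, i ≠ j → ∀ e : Sym2 V, ¬ (e ∈ (C i).edges ∧ e ∈ (C j).edges)

end SimpleGraph

/-!
Let `X` be a connected cubic graph and call the arcs of `mX` emanating from `v` the clique at `v`;
it has `3m` elements, and exactly `3m` edges of `K(mX)` leave it. A Hamilton cycle of `K(mX)`
leaves every clique, and by the degree-sum formula inside the clique it does so an even number of
times (`even_ncard_crossings`, `crossings_nonempty`). In a Hamilton decomposition, `⌊3m / 2⌋`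
edge-disjoint cycles thus share the `3m` edges leaving a clique, each using a positive even number
of them, so each uses exactly two. Contracting the cliques then turns any of the cycles into a
connected 2-regular spanning subgraph of `X` (`arcProjection_isSpanningCycle`), that is, into a
Hamilton cycle of `X`.

Neither the Petersen graph nor the Coxeter graph has a Hamilton cycle. The edges that such a cycle
of a cubic graph omits form a perfect matching, so it suffices to enumerate the perfect matchings
(6 and 84 of them) and to find that each has a disconnected complement. The enumeration
`allMatchingsDisconnect` is evaluated in the kernel, and `allMatchingsDisconnect_sound` connects it
to the graph. Both graphs are arc-transitive, which makes `K(mX)` vertex-transitive.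
-/

namespace SimpleGraph

/-! ### Hamilton cycles as connected 2-regular spanning subgraphs -/

/-- A graph is a spanning cycle if it is connected and every vertex has exactly two neighbours.
A Hamilton cycle of `X` is recorded below as a spanning cycle `H ≤ X`. -/
def IsSpanningCycle {V : Type*} (H : SimpleGraph V) : Prop :=
  H.Connected ∧ ∀ v, (H.neighborSet v).ncard = 2

theorem Connected.eq_univ_of_closed {V : Type*} {G : SimpleGraph V} (hG : G.Connected) {S : Set V}
    (hne : S.Nonempty) (hS : ∀ v ∈ S, ∀ w, G.Adj v w → w ∈ S) : S = Set.univ := by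
  obtain ⟨v, hv⟩ := hne
  refine Set.eq_univ_of_forall fun w => ?_
  obtain ⟨p⟩ := hG.preconnected v w
  induction p with
  | nil => exact hv
  | cons h _ ih => exact ih (hS _ hv _ h)

theorem Walk.IsHamiltonianCycle.isSpanningCycle {W : Type*} [DecidableEq W] {G : SimpleGraph W}
    {u : W} {c : G.Walk u u} (hc : c.IsHamiltonianCycle) :
    c.toSubgraph.spanningCoe.IsSpanningCycle := by
  refine ⟨?_, fun v => ?_⟩
  · exact c.toSubgraph_connected.coe.map c.toSubgraph.coeEmbeddingSpanningCoe.toHom fun v =>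
      ⟨⟨v, c.mem_verts_toSubgraph.2 (hc.mem_support v)⟩, rfl⟩
  · exact hc.isCycle.ncard_neighborSet_toSubgraph_eq_two (hc.mem_support v)

/-! ### Arcs of `mX` -/

section Arcs

variable {V : Type*} {X : SimpleGraph V} {m : ℕ}

/-- The reverse of an arc of `mX`: the arc `(y, x)_i` for the arc `(x, y)_i`. -/
def MultiArc.rev (a : X.MultiArc m) : X.MultiArc m := (a.1.symm, a.2)

theorem MultiArc.rev_rev (a : X.MultiArc m) : a.rev.rev = a := by
  simp [MultiArc.rev]

theorem MultiArc.rev_fst_ne (a : X.MultiArc m) : a.rev.1.fst ≠ a.1.fst :=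
  a.1.adj.ne.symm

theorem arcCliqueGraph_adj_iff {a b : X.MultiArc m} :
    (X.arcCliqueGraph m).Adj a b ↔ (a ≠ b ∧ a.1.fst = b.1.fst) ∨ b = a.rev := by
  refine or_congr Iff.rfl ?_
  constructor
  · rintro ⟨h, h'⟩
    exact Prod.ext (by simp [MultiArc.rev, h]) h'.symm
  · rintro rfl
    simp [MultiArc.rev]

theorem arcCliqueGraph_adj_rev (a : X.MultiArc m) : (X.arcCliqueGraph m).Adj a a.rev :=
  arcCliqueGraph_adj_iff.2 (Or.inr rfl)

theorem arcCliqueGraph_reachable_of_fst_eq {a b : X.MultiArc m} (h : a.1.fst = b.1.fst) :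
    (X.arcCliqueGraph m).Reachable a b := by
  by_cases hab : a = b
  · rw [hab]
  · exact (arcCliqueGraph_adj_iff.2 (Or.inl ⟨hab, h⟩)).reachable

theorem arcCliqueGraph_connected (hX : X.Connected) (hdeg : ∀ v, ∃ w, X.Adj v w) (hm : 1 ≤ m) :
    (X.arcCliqueGraph m).Connected := by
  have key : ∀ u v, X.Reachable u v → ∀ a b : X.MultiArc m, a.1.fst = u → b.1.fst = v →
      (X.arcCliqueGraph m).Reachable a b := by
    rintro u v ⟨p⟩
    induction p with
    | nil =>
      rintro a b ha hb
      exact arcCliqueGraph_reachable_of_fst_eq (ha.trans hb.symm)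
    | @cons u v w h p ih =>
      intro a b ha hb
      let d : X.MultiArc m := (⟨(u, v), h⟩, ⟨0, hm⟩)
      exact (arcCliqueGraph_reachable_of_fst_eq (b := d) ha).trans
        ((arcCliqueGraph_adj_rev d).reachable.trans (ih d.rev b rfl hb))
  obtain ⟨v⟩ := hX.nonempty
  obtain ⟨w, hw⟩ := hdeg v
  exact (connected_iff_exists_forall_reachable _).2
    ⟨(⟨(v, w), hw⟩, ⟨0, hm⟩), fun b => key _ _ (hX.preconnected _ _) _ b rfl rfl⟩

/-- The automorphism of `K(mX)` induced by an automorphism of `X` and a permutation of the copies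
that is the same for all edges. -/
def arcCliqueGraphIso (φ : X ≃g X) (σ : Equiv.Perm (Fin m)) :
    X.arcCliqueGraph m ≃g X.arcCliqueGraph m where
  toFun a := (φ.toHom.mapDart a.1, σ a.2)
  invFun a := (φ.symm.toHom.mapDart a.1, σ.symm a.2)
  left_inv a := by
    refine Prod.ext (Dart.ext _ _ (Prod.ext ?_ ?_)) ?_ <;> simp [Hom.mapDart]
  right_inv a := by
    refine Prod.ext (Dart.ext _ _ (Prod.ext ?_ ?_)) ?_ <;> simp [Hom.mapDart]
  map_rel_iff' := by
    intro a b
    simp only [arcCliqueGraph, ne_eq, Equiv.coe_fn_mk, Prod.ext_iff, Dart.ext_iff, Hom.mapDart,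
      Dart.symm, Prod.map_apply', EmbeddingLike.apply_eq_iff_eq,
      Prod.fst_swap, Prod.snd_swap, Iso.toHom, RelEmbedding.coe_toRelHom,
      RelIso.coe_toRelEmbedding]

/-- `K(mX)` is vertex-transitive when `X` is arc-transitive. -/
theorem arcCliqueGraph_isVertexTransitive
    (hX : ∀ d e : X.Dart, ∃ φ : X ≃g X, φ d.fst = e.fst ∧ φ d.snd = e.snd) :
    (X.arcCliqueGraph m).IsVertexTransitive := by
  intro a b
  obtain ⟨φ, h1, h2⟩ := hX a.1 b.1
  refine ⟨arcCliqueGraphIso φ (Equiv.swap a.2 b.2), ?_⟩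
  exact Prod.ext (Dart.ext _ _ (Prod.ext h1 h2)) (Equiv.swap_apply_left _ _)

variable [Fintype V] [DecidableRel X.Adj]

theorem card_multiArc : Nat.card (X.MultiArc m) = (∑ v, X.degree v) * m := by
  rw [Nat.card_eq_fintype_card, Fintype.card_prod, dart_card_eq_sum_degrees, Fintype.card_fin]

variable [DecidableEq V]

theorem card_filter_multiArc_fst_eq (v : V) :
    (Finset.univ.filter fun a : X.MultiArc m => a.1.fst = v).card = X.degree v * m := by
  have h : (Finset.univ.filter fun a : X.MultiArc m => a.1.fst = v) =
      (Finset.univ.filter fun d : X.Dart => d.fst = v) ×ˢ Finset.univ := by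
    ext; simp
  rw [h, Finset.card_product, dart_fst_fiber_card_eq_degree, Finset.card_univ, Fintype.card_fin]

theorem arcCliqueGraph_isRegularOfDegree {k : ℕ} (hX : X.IsRegularOfDegree k) :
    (X.arcCliqueGraph m).IsRegularOfDegree (k * m) := by
  intro a
  have h : (X.arcCliqueGraph m).neighborFinset a =
      insert a.rev ((Finset.univ.filter fun b : X.MultiArc m => b.1.fst = a.1.fst).erase a) := by
    ext b
    rw [mem_neighborFinset, arcCliqueGraph_adj_iff]
    simp only [Finset.mem_insert, Finset.mem_erase, Finset.mem_filter, Finset.mem_univ, true_and]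
    grind
  have ha : a ∈ Finset.univ.filter fun b : X.MultiArc m => b.1.fst = a.1.fst := by simp
  rw [← card_neighborFinset_eq_degree, h, Finset.card_insert_of_notMem, Finset.card_erase_of_mem ha,
    card_filter_multiArc_fst_eq, hX.degree_eq]
  · have := Finset.card_pos.2 ⟨a, ha⟩
    rw [card_filter_multiArc_fst_eq, hX.degree_eq] at this
    omega
  · simp [a.rev_fst_ne]

end Arcs

/-! ### Crossings of a spanning cycle -/

section Crossings

variable {V : Type*} {X : SimpleGraph V} {m : ℕ}

/-- The arcs emanating from `v` whose edge to the reverse arc lies in `H`: the edges of `H` that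
leave the clique of `K(mX)` at `v`. -/
def crossings (H : SimpleGraph (X.MultiArc m)) (v : V) : Set (X.MultiArc m) :=
  {a | a.1.fst = v ∧ H.Adj a a.rev}

/-- The projection to `X` of a subgraph of `K(mX)`. -/
def arcProjection (H : SimpleGraph (X.MultiArc m)) : SimpleGraph V where
  Adj u v := ∃ a : X.MultiArc m, a.1.fst = u ∧ a.1.snd = v ∧ H.Adj a a.rev
  symm := ⟨by
    rintro u v ⟨a, rfl, rfl, h⟩
    exact ⟨a.rev, rfl, rfl, by rw [MultiArc.rev_rev]; exact h.symm⟩⟩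
  loopless := ⟨by
    rintro u ⟨a, h, h', -⟩
    exact a.1.adj.ne (h.trans h'.symm)⟩

theorem arcProjection_le (H : SimpleGraph (X.MultiArc m)) : arcProjection H ≤ X := by
  rintro u v ⟨a, rfl, rfl, -⟩
  exact a.1.adj

variable {H : SimpleGraph (X.MultiArc m)}

theorem arcProjection_connected (hle : H ≤ X.arcCliqueGraph m) (hH : H.Connected) (hm : 1 ≤ m)
    (hdeg : ∀ v, ∃ w, X.Adj v w) : (arcProjection H).Connected := by
  have key : ∀ a b, H.Reachable a b → (arcProjection H).Reachable a.1.fst b.1.fst := by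
    rintro a b ⟨p⟩
    induction p with
    | nil => rfl
    | cons h p ih =>
      refine Reachable.trans ?_ ih
      rcases arcCliqueGraph_adj_iff.1 (hle h) with ⟨-, h'⟩ | rfl
      · rw [h']
      · exact Adj.reachable ⟨_, rfl, rfl, h⟩
  obtain ⟨a⟩ := hH.nonempty
  refine (connected_iff_exists_forall_reachable _).2 ⟨a.1.fst, fun v => ?_⟩
  obtain ⟨w, hw⟩ := hdeg v
  exact key a (⟨(v, w), hw⟩, ⟨0, hm⟩) (hH.preconnected _ _)

/-- If a connected `H ≤ K(mX)` leaves every clique exactly twice, its projection to `X` is a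
spanning cycle: two crossings at `v` leading to the same vertex `y` would make `{v, y}` a
component. -/
theorem arcProjection_isSpanningCycle [Finite V] (hle : H ≤ X.arcCliqueGraph m)
    (hH : H.Connected) (hm : 1 ≤ m) (hdeg : ∀ v, ∃ w, X.Adj v w) (hV : 2 < Nat.card V)
    (hcr : ∀ v, (crossings H v).ncard = 2) : (arcProjection H).IsSpanningCycle := by
  have hconn := arcProjection_connected hle hH hm hdeg
  refine ⟨hconn, fun v => ?_⟩
  obtain ⟨a, b, hab, hv⟩ := Set.ncard_eq_two.1 (hcr v)
  have ha : a ∈ crossings H v := hv ▸ Set.mem_insert _ _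
  have hb : b ∈ crossings H v := hv ▸ Set.mem_insert_of_mem _ rfl
  have hrev : ∀ c ∈ crossings H v, c.rev ∈ crossings H c.1.snd := fun c hc =>
    ⟨rfl, by rw [MultiArc.rev_rev]; exact hc.2.symm⟩
  have hne : a.1.snd ≠ b.1.snd := by
    intro h
    obtain ⟨c, d, -, hy⟩ := Set.ncard_eq_two.1 (hcr a.1.snd)
    have h1 : a.rev ∈ crossings H a.1.snd := hrev a ha
    have h2 : b.rev ∈ crossings H a.1.snd := h ▸ hrev b hb
    have h3 : a.rev ≠ b.rev := fun h' => hab (by rw [← a.rev_rev, h', b.rev_rev])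
    have hfst : ∀ e ∈ crossings H a.1.snd, e.1.snd = v := by
      intro e he
      rw [hy] at he h1 h2
      have : e = a.rev ∨ e = b.rev := by
        simp only [Set.mem_insert_iff, Set.mem_singleton_iff] at he h1 h2
        grind
      rcases this with rfl | rfl
      · exact ha.1
      · exact hb.1
    have huniv : ({v, a.1.snd} : Set V) = Set.univ := by
      refine hconn.eq_univ_of_closed ⟨v, Set.mem_insert _ _⟩ ?_
      rintro x (rfl | rfl) w ⟨e, he, rfl, he'⟩
      · have : e ∈ crossings H x := ⟨he, he'⟩
        rw [hv] at this
        rcases this with rfl | rfl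
        · exact Or.inr rfl
        · exact Or.inr h.symm
      · exact Or.inl (hfst e ⟨he, he'⟩)
    have h4 : ({v, a.1.snd} : Set V).ncard ≤ 2 :=
      (Set.ncard_insert_le _ _).trans (by rw [Set.ncard_singleton])
    rw [huniv, Set.ncard_univ] at h4
    omega
  have himg : (arcProjection H).neighborSet v = {a.1.snd, b.1.snd} := by
    ext w
    constructor
    · rintro ⟨e, he, rfl, he'⟩
      have : e ∈ crossings H v := ⟨he, he'⟩
      rw [hv] at this
      rcases this with rfl | rfl
      · exact Or.inl rfl
      · exact Or.inr rfl
    · rintro (rfl | rfl)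
      · exact ⟨a, ha.1, rfl, ha.2⟩
      · exact ⟨b, hb.1, rfl, hb.2⟩
  rw [himg, Set.ncard_pair hne]

/-- By the degree-sum formula inside the clique at `v`, a 2-regular subgraph of `K(mX)` leaves
that clique an even number of times. -/
theorem even_ncard_crossings [Finite V] (hle : H ≤ X.arcCliqueGraph m)
    (hH : ∀ a, (H.neighborSet a).ncard = 2) (v : V) : Even (crossings H v).ncard := by
  classical
  have := Fintype.ofFinite V
  -- the part of `H` inside the clique at `v`
  let I : SimpleGraph (X.MultiArc m) :=
    { Adj := fun a b => H.Adj a b ∧ a.1.fst = v ∧ b.1.fst = v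
      symm := ⟨fun a b h => ⟨h.1.symm, h.2.2, h.2.1⟩⟩
      loopless := ⟨fun a h => H.loopless.irrefl a h.1⟩ }
  have hdeg : ∀ a : X.MultiArc m, I.degree a + (if a ∈ crossings H v then 1 else 0) =
      if a.1.fst = v then 2 else 0 := by
    intro a
    by_cases ha : a.1.fst = v
    · have hset : H.neighborFinset a =
          I.neighborFinset a ∪ (if a ∈ crossings H v then {a.rev} else ∅) := by
        ext b
        rw [Finset.mem_union, mem_neighborFinset, mem_neighborFinset]
        constructor
        · intro hb
          rcases arcCliqueGraph_adj_iff.1 (hle hb) with ⟨-, h⟩ | rfl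
          · exact Or.inl ⟨hb, ha, h ▸ ha⟩
          · right
            rw [if_pos ⟨ha, hb⟩]
            simp
        · rintro (h | h)
          · exact h.1
          · split_ifs at h with h'
            · rw [Finset.mem_singleton.1 h]
              exact h'.2
            · simp at h
      have hdisj : Disjoint (I.neighborFinset a)
          (if a ∈ crossings H v then {a.rev} else ∅) := by
        split_ifs
        · rw [Finset.disjoint_singleton_right, mem_neighborFinset]
          rintro ⟨-, -, h⟩
          exact a.rev_fst_ne (h.trans ha.symm)
        · exact Finset.disjoint_empty_right _
      have h2 := hH a
      rw [← coe_neighborFinset, Set.ncard_coe_finset, hset, Finset.card_union_of_disjoint hdisj,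
        card_neighborFinset_eq_degree] at h2
      rw [if_pos ha, ← h2]
      split_ifs <;> simp
    · have h1 : I.degree a = 0 := by
        rw [← card_neighborFinset_eq_degree, Finset.card_eq_zero, Finset.eq_empty_iff_forall_notMem]
        intro b hb
        exact ha ((mem_neighborFinset _ _ _).1 hb).2.1
      rw [h1, if_neg ha, if_neg (fun h => ha h.1)]
  have hsum := Finset.sum_congr (rfl : (Finset.univ : Finset (X.MultiArc m)) = _)
    fun a _ => hdeg a
  rw [Finset.sum_add_distrib, sum_degrees_eq_twice_card_edges, Finset.sum_boole] at hsum
  have h3 : (crossings H v).ncard =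
      (Finset.univ.filter fun a : X.MultiArc m => a ∈ crossings H v).card := by
    rw [← Set.ncard_coe_finset]
    simp
  have h4 : (∑ a : X.MultiArc m, if a.1.fst = v then 2 else 0) =
      2 * (Finset.univ.filter fun a : X.MultiArc m => a.1.fst = v).card := by
    rw [← Finset.sum_filter, Finset.sum_const, smul_eq_mul, mul_comm]
  rw [h4, Nat.cast_id, ← h3] at hsum
  exact ⟨(Finset.univ.filter fun a : X.MultiArc m => a.1.fst = v).card - I.edgeFinset.card,
    by omega⟩

theorem crossings_nonempty (hle : H ≤ X.arcCliqueGraph m) (hH : H.Connected) (hm : 1 ≤ m)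
    (hdeg : ∀ v, ∃ w, X.Adj v w) (v : V) : (crossings H v).Nonempty := by
  by_contra hempty
  obtain ⟨w, hw⟩ := hdeg v
  let a : X.MultiArc m := (⟨(v, w), hw⟩, ⟨0, hm⟩)
  have huniv : {b : X.MultiArc m | b.1.fst = v} = Set.univ := by
    refine hH.eq_univ_of_closed ⟨a, rfl⟩ fun b hb c hbc => ?_
    rcases arcCliqueGraph_adj_iff.1 (hle hbc) with ⟨-, h⟩ | rfl
    · exact h.symm.trans hb
    · exact absurd ⟨b, hb, hbc⟩ hempty
  have : a.rev ∈ {b : X.MultiArc m | b.1.fst = v} := huniv ▸ Set.mem_univ _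
  exact a.rev_fst_ne this

/-- A Hamilton decomposition of `K(mX)` yields a spanning cycle of the cubic graph `X`. Each of
the `⌊3m / 2⌋` cycles leaves every clique at least twice, and an even number of times, while only
`3m` edges leave the clique; so each of them leaves every clique exactly twice. -/
theorem exists_isSpanningCycle_of_hasHamiltonDecomposition [Fintype V] [DecidableEq V]
    [DecidableRel X.Adj] (hX : X.IsRegularOfDegree 3) (hV : 2 < Nat.card V) (hm : 1 ≤ m)
    (h : (X.arcCliqueGraph m).HasHamiltonDecomposition (3 * m)) :
    ∃ P ≤ X, P.IsSpanningCycle := by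
  obtain ⟨base, C, hC, hdisj⟩ := h
  have hdeg : ∀ v, ∃ w, X.Adj v w := fun v =>
    (X.degree_pos_iff_exists_adj v).1 (by rw [hX.degree_eq]; norm_num)
  let H := fun j => (C j).toSubgraph.spanningCoe
  have hle : ∀ j, H j ≤ X.arcCliqueGraph m := fun j => Subgraph.spanningCoe_le _
  have hH : ∀ j, (H j).IsSpanningCycle := fun j => (hC j).isSpanningCycle
  have hge : ∀ j v, 2 ≤ (crossings (H j) v).ncard := by
    intro j v
    have h1 := even_ncard_crossings (hle j) (hH j).2 v
    have h2 := (Set.ncard_pos).2 (crossings_nonempty (hle j) (hH j).1 hm hdeg v)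
    obtain ⟨r, hr⟩ := h1
    omega
  have hsum : ∀ v, ∑ j, (crossings (H j) v).ncard ≤ 3 * m := by
    intro v
    classical
    have hpd : ∀ i j, i ≠ j → Disjoint (crossings (H i) v) (crossings (H j) v) := by
      intro i j hij
      refine Set.disjoint_left.2 fun a hi hj => hdisj i j hij s(a, a.rev) ⟨?_, ?_⟩
      · exact Walk.adj_toSubgraph_iff_mem_edges.1 hi.2
      · exact Walk.adj_toSubgraph_iff_mem_edges.1 hj.2
    calc ∑ j, (crossings (H j) v).ncard
        = ∑ j, (crossings (H j) v).toFinset.card := by simp_rw [Set.ncard_eq_toFinset_card']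
      _ = (Finset.univ.biUnion fun j => (crossings (H j) v).toFinset).card := by
          rw [Finset.card_biUnion]
          intro i _ j _ hij
          exact Set.disjoint_toFinset.2 (hpd i j hij)
      _ ≤ (Finset.univ.filter fun a : X.MultiArc m => a.1.fst = v).card := by
          refine Finset.card_le_card fun a ha => ?_
          simp only [Finset.mem_biUnion, Finset.mem_univ, true_and, Set.mem_toFinset] at ha
          obtain ⟨j, hj⟩ := ha
          exact Finset.mem_filter.2 ⟨Finset.mem_univ _, hj.1⟩
      _ = 3 * m := by rw [card_filter_multiArc_fst_eq, hX.degree_eq]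
  let j₀ : Fin (3 * m / 2) := ⟨0, by omega⟩
  refine ⟨arcProjection (H j₀), arcProjection_le _,
    arcProjection_isSpanningCycle (hle j₀) (hH j₀).1 hm hdeg hV fun v => ?_⟩
  have h1 := Finset.add_sum_erase Finset.univ (fun j => (crossings (H j) v).ncard)
    (Finset.mem_univ j₀)
  have h2 : (Finset.univ.erase j₀).card * 2 ≤
      ∑ j ∈ Finset.univ.erase j₀, (crossings (H j) v).ncard := by
    rw [← smul_eq_mul]
    exact Finset.card_nsmul_le_sum _ _ _ fun j _ => hge j v
  rw [Finset.card_erase_of_mem (Finset.mem_univ _), Finset.card_univ, Fintype.card_fin] at h2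
  have h3 := hsum v
  have h4 := hge j₀ v
  -- for odd `m` the count alone would allow three crossings; parity excludes this
  obtain ⟨r, hr⟩ := even_ncard_crossings (hle j₀) (hH j₀).2 v
  omega

end Crossings

/-! ### Search over the edges omitted by a spanning cycle -/

/-- A spanning cycle of a cubic graph omits one edge at each vertex. The map `f` sends a vertex to
the other end of the omitted edge, so it is an involution, and no proper nonempty set of vertices is
closed under the edges that are not omitted. -/
theorem IsSpanningCycle.exists_omitted {V : Type*} [Fintype V] {X P : SimpleGraph V}
    [DecidableRel X.Adj] (hX : X.IsRegularOfDegree 3) (hle : P ≤ X) (hP : P.IsSpanningCycle) :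
    ∃ f : V → V, (∀ v, X.Adj v (f v)) ∧ (∀ v, f (f v) = v) ∧
      ∀ S : Set V, S.Nonempty → (∀ v ∈ S, ∀ w, X.Adj v w → f v ≠ w → w ∈ S) → S = Set.univ := by
  have h1 : ∀ v, ∃ w, X.neighborSet v \ P.neighborSet v = {w} := by
    intro v
    have hsub : P.neighborSet v ⊆ X.neighborSet v := fun w hw => hle hw
    rw [← Set.ncard_eq_one, Set.ncard_sdiff hsub, hP.2 v, ← coe_neighborFinset,
      Set.ncard_coe_finset, card_neighborFinset_eq_degree, hX.degree_eq]
  choose f hf using h1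
  have h2 : ∀ v w, X.Adj v w ∧ ¬ P.Adj v w ↔ w = f v := fun v w => Set.ext_iff.1 (hf v) w
  refine ⟨f, fun v => ((h2 v _).2 rfl).1, fun v => ?_, fun S hne hS => ?_⟩
  · have h3 := (h2 v _).2 rfl
    exact ((h2 (f v) v).1 ⟨h3.1.symm, fun h => h3.2 h.symm⟩).symm
  · refine hP.1.eq_univ_of_closed hne fun v hv w hvw => hS v hv w (hle hvw) ?_
    rintro rfl
    exact ((h2 v _).2 rfl).2 hvw

/-- Whether the list `L` of pairs contains the pair `(a, b)`. -/
def hasPair (L : List (ℕ × ℕ)) (a b : ℕ) : Bool := L.any fun p => p.1 == a && p.2 == b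

/-- The vertices met on a walk from `cur` that never uses an edge listed in `L` and does not turn
back to `prev`, added to `A`. The walk stops at a vertex already met. -/
def walkAvoiding (nbr : ℕ → List ℕ) (L : List (ℕ × ℕ)) : ℕ → ℕ → ℕ → List ℕ → List ℕ
  | 0, _, _, A => A
  | k + 1, prev, cur, A =>
    if A.contains cur then A else
      match (nbr cur).find? fun b => b != prev && !hasPair L cur b with
      | none => cur :: A
      | some b => walkAvoiding nbr L k cur b (cur :: A)

/-- Whether `A` contains some, but not all, of `verts`, and is closed under the edges not listed
in `L`. -/
def isProperClosed (nbr : ℕ → List ℕ) (verts : List ℕ) (L : List (ℕ × ℕ)) (A : List ℕ) : Bool :=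
  verts.any (fun a => A.contains a) && verts.any (fun a => !A.contains a) &&
    A.all fun a => (nbr a).all fun b => hasPair L a b || A.contains b

/-- A depth-first search through the perfect matchings extending the partial matching `L`: the
first unmatched vertex is matched with each of its neighbours in turn, and every perfect matching
that is reached is tested for whether its complement is disconnected. The first argument bounds the
depth: it has to exceed the number of edges of a perfect matching. A neighbour `b` of `a` is skipped
if `b` is already matched with a vertex other than `a`. -/
def allMatchingsDisconnect (nbr : ℕ → List ℕ) (verts : List ℕ) : ℕ → List (ℕ × ℕ) → Bool
  | 0, _ => false
  | k + 1, L =>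
    match verts.find? fun a => !(L.any fun p => p.1 == a) with
    | none => isProperClosed nbr verts L (walkAvoiding nbr L verts.length 0 (verts.headD 0) [])
    | some a => (nbr a).all fun b =>
        (L.any fun p => p.1 == b && p.2 != a) ||
          allMatchingsDisconnect nbr verts k ((a, b) :: (b, a) :: L)

section Soundness

variable {V : Type*} {X : SimpleGraph V} {c : V → ℕ} {nbr : ℕ → List ℕ} {verts : List ℕ}
  {f : V → V} {L : List (ℕ × ℕ)}

theorem hasPair_sound (hc : Function.Injective c) (hL : ∀ p ∈ L, ∀ v, c v = p.1 → c (f v) = p.2)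
    {v w : V} (h : hasPair L (c v) (c w) = true) : f v = w := by
  obtain ⟨p, hp, h⟩ := List.any_eq_true.1 h
  simp only [Bool.and_eq_true, beq_iff_eq] at h
  exact hc ((hL p hp v h.1.symm).trans h.2)

/-- The set `A` and the way it was found play no role for correctness: any set that passes the test
contradicts the connectedness of the complement of the matching `f`. -/
theorem isProperClosed_sound (hc : Function.Injective c) (hv : ∀ a ∈ verts, ∃ v, c v = a)
    (hn : ∀ v w, X.Adj v w → c w ∈ nbr (c v))
    (hconn : ∀ S : Set V, S.Nonempty → (∀ v ∈ S, ∀ w, X.Adj v w → f v ≠ w → w ∈ S) → S = Set.univ)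
    (hL : ∀ p ∈ L, ∀ v, c v = p.1 → c (f v) = p.2) {A : List ℕ} :
    isProperClosed nbr verts L A = false := by
  by_contra h
  simp only [Bool.not_eq_false, isProperClosed, Bool.and_eq_true, List.any_eq_true, List.all_eq_true,
    Bool.or_eq_true, Bool.not_eq_true', List.contains_eq_mem, decide_eq_true_eq,
    decide_eq_false_iff_not] at h
  obtain ⟨⟨⟨a, ha, haA⟩, b, hb, hbA⟩, hcl⟩ := h
  obtain ⟨v, rfl⟩ := hv a ha
  obtain ⟨w, rfl⟩ := hv b hb
  have huniv : {x | c x ∈ A} = Set.univ := by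
    refine hconn _ ⟨v, haA⟩ fun x hx y hxy hne => ?_
    exact (hcl _ hx _ (hn x y hxy)).resolve_left fun h => hne (hasPair_sound hc hL h)
  exact hbA (huniv.symm ▸ Set.mem_univ w : w ∈ {x | c x ∈ A})

/-- The search cannot succeed if there is a perfect matching `f` with connected complement: it would
follow the branch on which every choice agrees with `f`. -/
theorem allMatchingsDisconnect_sound (hc : Function.Injective c)
    (hv : ∀ a ∈ verts, ∃ v, c v = a) (hn : ∀ v w, X.Adj v w → c w ∈ nbr (c v))
    (hadj : ∀ v, X.Adj v (f v)) (hf : ∀ v, f (f v) = v)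
    (hconn : ∀ S : Set V, S.Nonempty → (∀ v ∈ S, ∀ w, X.Adj v w → f v ≠ w → w ∈ S) → S = Set.univ)
    (k : ℕ) (hL : ∀ p ∈ L, ∀ v, c v = p.1 → c (f v) = p.2) :
    allMatchingsDisconnect nbr verts k L = false := by
  induction k generalizing L with
  | zero => rfl
  | succ k ih =>
    rw [allMatchingsDisconnect]
    split
    · exact isProperClosed_sound hc hv hn hconn hL
    · rename_i a ha
      obtain ⟨v, rfl⟩ := hv a (List.mem_of_find?_eq_some ha)
      rw [List.all_eq_false]
      refine ⟨c (f v), hn _ _ (hadj v), ?_⟩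
      rw [Bool.not_eq_true, Bool.or_eq_false_iff]
      constructor
      · rw [List.any_eq_false]
        intro p hp h
        simp only [Bool.and_eq_true, beq_iff_eq, bne_iff_ne] at h
        exact h.2 (by rw [← hL p hp _ h.1.symm, hf])
      · refine ih fun p hp x hx => ?_
        rcases List.mem_cons.1 hp with rfl | hp
        · rw [hc hx]
        · rcases List.mem_cons.1 hp with rfl | hp
          · rw [hc hx, hf]
          · exact hL p hp x hx

/-- A cubic graph whose vertices are encoded by the numbers in `verts` has no spanning cycle if
the search finds no perfect matching with connected complement. -/
theorem not_isSpanningCycle_of_allMatchingsDisconnect [Fintype V] [DecidableRel X.Adj]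
    (hX : X.IsRegularOfDegree 3) (hc : Function.Injective c) (hv : ∀ a ∈ verts, ∃ v, c v = a)
    (hn : ∀ v w, X.Adj v w → c w ∈ nbr (c v)) {k : ℕ}
    (hs : allMatchingsDisconnect nbr verts k [] = true) {P : SimpleGraph V} (hle : P ≤ X) :
    ¬ P.IsSpanningCycle := by
  intro hP
  obtain ⟨f, hadj, hf, hconn⟩ := hP.exists_omitted hX hle
  have := allMatchingsDisconnect_sound hc hv hn hadj hf hconn k (L := []) (by simp)
  rw [hs] at this
  exact absurd this (by decide)

end Soundness

/-! ### Graphs of disjoint subsets -/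

section DisjointSubsets

variable {n : ℕ} {p : Finset (Fin n) → Prop} {X : SimpleGraph {s // p s}}

/-- A permutation of the points that preserves the family `p` acts on a graph whose vertices are
the members of `p` and whose adjacency is disjointness. -/
theorem exists_iso_map (hX : ∀ s t, X.Adj s t ↔ Disjoint s.1 t.1) (σ : Equiv.Perm (Fin n))
    (hσ : ∀ s, p s ↔ p (s.map σ.toEmbedding)) :
    ∃ φ : X ≃g X, ∀ s, (φ s).1 = s.1.map σ.toEmbedding := by
  refine ⟨⟨(Equiv.finsetCongr σ).subtypeEquiv hσ, ?_⟩, fun s => rfl⟩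
  intro s t
  rw [hX, hX]
  exact Finset.disjoint_map σ.toEmbedding

/-- The code of a set of points: the number whose binary digits are its indicator function. -/
def setCode (s : Finset (Fin n)) : ℕ := ∑ i ∈ s, 2 ^ (i : ℕ)

/-- The members of `verts` whose binary digits are disjoint from those of `a`. -/
def disjointCodes (verts : List ℕ) (a : ℕ) : List ℕ := verts.filter fun b => a &&& b == 0

end DisjointSubsets

/-! ### Arc-transitivity and connectedness -/

/-- Arc-transitivity follows from vertex-transitivity and transitivity of the stabilizer of one
vertex on its neighbours. -/
theorem exists_iso_dart_of_base {V : Type*} {X : SimpleGraph V} (s₀ t₀ : V)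
    (hv : ∀ s, ∃ φ : X ≃g X, φ s = s₀)
    (hs : ∀ t, X.Adj s₀ t → ∃ φ : X ≃g X, φ s₀ = s₀ ∧ φ t = t₀) (d e : X.Dart) :
    ∃ φ : X ≃g X, φ d.fst = e.fst ∧ φ d.snd = e.snd := by
  have key : ∀ d : X.Dart, ∃ φ : X ≃g X, φ d.fst = s₀ ∧ φ d.snd = t₀ := by
    intro d
    obtain ⟨φ, hφ⟩ := hv d.fst
    obtain ⟨ψ, h1, h2⟩ := hs (φ d.snd) (hφ ▸ φ.map_adj_iff.2 d.adj)
    exact ⟨φ.trans ψ, by simp [hφ, h1], by simp [h2]⟩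
  obtain ⟨φ, h1, h2⟩ := key d
  obtain ⟨ψ, h3, h4⟩ := key e
  refine ⟨φ.trans ψ.symm, ?_, ?_⟩
  · rw [RelIso.trans_apply, h1, ← h3, RelIso.symm_apply_apply]
  · rw [RelIso.trans_apply, h2, ← h4, RelIso.symm_apply_apply]

/-- The vertices at distance at most one from `S`. -/
def closedNeighborhood {V : Type*} [Fintype V] [DecidableEq V] (X : SimpleGraph V)
    [DecidableRel X.Adj] (S : Finset V) : Finset V :=
  Finset.univ.filter fun t => t ∈ S ∨ ∃ u ∈ S, X.Adj u t

theorem connected_of_iterate_closedNeighborhood {V : Type*} [Fintype V] [DecidableEq V]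
    {X : SimpleGraph V} [DecidableRel X.Adj] (s : V) (k : ℕ)
    (h : X.closedNeighborhood^[k] {s} = Finset.univ) : X.Connected := by
  have key : ∀ k, ∀ t ∈ X.closedNeighborhood^[k] {s}, X.Reachable s t := by
    intro k
    induction k with
    | zero =>
      intro t ht
      rw [Finset.mem_singleton.1 ht]
    | succ k ih =>
      intro t ht
      rw [Function.iterate_succ_apply'] at ht
      rcases (Finset.mem_filter.1 ht).2 with ht | ⟨u, hu, hut⟩
      · exact ih t ht
      · exact (ih u hu).trans hut.reachable
  exact (connected_iff_exists_forall_reachable _).2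
    ⟨s, fun t => key k t (h.symm ▸ Finset.mem_univ t)⟩

/-! ### The graph `K(mX)` of a cubic arc-transitive graph -/

/-- All the properties of `K(mX)` at once, for a connected cubic arc-transitive graph `X` without a
spanning cycle. -/
theorem arcCliqueGraph_properties {V : Type*} [Fintype V] [DecidableEq V] {X : SimpleGraph V}
    [DecidableRel X.Adj] (hconn : X.Connected) (hX : X.IsRegularOfDegree 3)
    (htrans : ∀ d e : X.Dart, ∃ φ : X ≃g X, φ d.fst = e.fst ∧ φ d.snd = e.snd)
    (hV : 2 < Nat.card V) (hP : ∀ P ≤ X, ¬ P.IsSpanningCycle) {m : ℕ} (hm : 1 ≤ m) :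
    (X.arcCliqueGraph m).Connected ∧ (X.arcCliqueGraph m).IsRegularOfDegree (3 * m) ∧
      Nat.card (X.MultiArc m) = Nat.card V * 3 * m ∧ (X.arcCliqueGraph m).IsVertexTransitive ∧
      ¬ (X.arcCliqueGraph m).HasHamiltonDecomposition (3 * m) := by
  refine ⟨arcCliqueGraph_connected hconn (fun v => ?_) hm, arcCliqueGraph_isRegularOfDegree hX, ?_,
    arcCliqueGraph_isVertexTransitive htrans, fun h => ?_⟩
  · exact (X.degree_pos_iff_exists_adj v).1 (by rw [hX.degree_eq]; norm_num)
  · rw [card_multiArc, Finset.sum_congr rfl fun v _ => hX.degree_eq v, Finset.sum_const,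
      Finset.card_univ, smul_eq_mul, Nat.card_eq_fintype_card]
  · obtain ⟨P, hle, h⟩ := exists_isSpanningCycle_of_hasHamiltonDecomposition hX hV hm h
    exact hP P hle h

/-! ### The Petersen graph -/

theorem petersenGraph_isRegularOfDegree : petersenGraph.IsRegularOfDegree 3 := by
  unfold IsRegularOfDegree
  decide +kernel

theorem petersenGraph_connected : petersenGraph.Connected :=
  connected_of_iterate_closedNeighborhood ⟨{0, 1}, rfl⟩ 2 (by decide +kernel)

/-- The codes of the vertices of the Petersen graph. -/
def petersenCodes : List ℕ := [3, 5, 9, 17, 6, 10, 18, 12, 20, 24]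

theorem petersenGraph_not_isSpanningCycle {P : SimpleGraph {s : Finset (Fin 5) // s.card = 2}}
    (hle : P ≤ petersenGraph) : ¬ P.IsSpanningCycle := by
  refine not_isSpanningCycle_of_allMatchingsDisconnect (c := fun s => setCode s.1)
    (verts := petersenCodes) (nbr := disjointCodes petersenCodes) (k := 6)
    petersenGraph_isRegularOfDegree ?_ ?_ ?_ ?_ hle
  · unfold Function.Injective
    decide +kernel
  · decide +kernel
  · decide +kernel
  · decide +kernel

/-- The permutation `x ↦ x + 1` of the integers modulo `n`. -/
def shift (n : ℕ) [NeZero n] : Equiv.Perm (Fin n) := Equiv.addRight 1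

/-- The permutation `x ↦ 2x` of the integers modulo `5`. -/
def double5 : Equiv.Perm (Fin 5) where
  toFun x := 2 * x
  invFun x := 3 * x
  left_inv := by decide
  right_inv := by decide

/-- The affine group modulo `5` is transitive on pairs, and the cyclic permutation of `{2, 3, 4}`
fixes the vertex `{0, 1}` and is transitive on its neighbours. -/
theorem petersenGraph_arcTransitive (d e : petersenGraph.Dart) :
    ∃ φ : petersenGraph ≃g petersenGraph, φ d.fst = e.fst ∧ φ d.snd = e.snd := by
  have hφ := fun σ => exists_iso_map (X := petersenGraph) (fun _ _ => Iff.rfl) σ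
    fun s => by rw [Finset.card_map]
  refine exists_iso_dart_of_base ⟨{0, 1}, rfl⟩ ⟨{2, 3}, rfl⟩ (fun s => ?_) (fun t ht => ?_) d e
  · have h : ∀ s : {s : Finset (Fin 5) // s.card = 2}, ∃ i : Fin 5, ∃ j : Fin 2,
        s.1.map (shift 5 ^ (i : ℕ) * double5 ^ (j : ℕ)).toEmbedding = {0, 1} := by
      decide +kernel
    obtain ⟨i, j, h⟩ := h s
    obtain ⟨φ, hφ⟩ := hφ (shift 5 ^ (i : ℕ) * double5 ^ (j : ℕ))
    exact ⟨φ, Subtype.ext ((hφ s).trans h)⟩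
  · let σ : Equiv.Perm (Fin 5) := Equiv.swap 2 3 * Equiv.swap 3 4
    have h : ∀ t : {s : Finset (Fin 5) // s.card = 2}, Disjoint {0, 1} t.1 → ∃ i : Fin 3,
        ({0, 1} : Finset (Fin 5)).map (σ ^ (i : ℕ)).toEmbedding = {0, 1} ∧
          t.1.map (σ ^ (i : ℕ)).toEmbedding = {2, 3} := by
      decide +kernel
    obtain ⟨i, h1, h2⟩ := h t ht
    obtain ⟨φ, hφ⟩ := hφ (σ ^ (i : ℕ))
    exact ⟨φ, Subtype.ext ((hφ _).trans h1), Subtype.ext ((hφ t).trans h2)⟩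

/-! ### The Coxeter graph -/

/-- The vertices of the Coxeter graph: the non-collinear triples of points of the Fano plane. -/
def IsFanoTriangle (s : Finset (Fin 7)) : Prop :=
  s.card = 3 ∧ ∀ i : Fin 7, s ≠ {i, i + 1, i + 3}

instance : DecidablePred IsFanoTriangle := fun s =>
  inferInstanceAs (Decidable (s.card = 3 ∧ ∀ i : Fin 7, s ≠ {i, i + 1, i + 3}))

theorem coxeterGraph_isRegularOfDegree : coxeterGraph.IsRegularOfDegree 3 := by
  unfold IsRegularOfDegree
  decide +kernel

theorem coxeterGraph_connected : coxeterGraph.Connected :=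
  connected_of_iterate_closedNeighborhood ⟨{3, 5, 6}, by decide⟩ 4 (by decide +kernel)

/-- The codes of the vertices of the Coxeter graph, in an order in which each vertex has many
neighbours among its predecessors; this keeps the search for perfect matchings small. -/
def coxeterCodes : List ℕ :=
  [7, 56, 67, 70, 25, 41, 38, 73, 52, 81, 14, 112, 13, 50, 82, 37, 74, 21, 42, 84, 104, 19, 76, 35,
    28, 97, 26, 100]

theorem coxeterGraph_not_isSpanningCycle {P : SimpleGraph {s : Finset (Fin 7) // IsFanoTriangle s}}
    (hle : P ≤ coxeterGraph) : ¬ P.IsSpanningCycle := by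
  refine not_isSpanningCycle_of_allMatchingsDisconnect (c := fun s => setCode s.1)
    (verts := coxeterCodes) (nbr := disjointCodes coxeterCodes) (k := 15)
    coxeterGraph_isRegularOfDegree ?_ ?_ ?_ ?_ hle
  · unfold Function.Injective
    decide +kernel
  · decide +kernel
  · decide +kernel
  · decide +kernel

/-- The permutation `x ↦ 2x` of the integers modulo `7`. -/
def double7 : Equiv.Perm (Fin 7) where
  toFun x := 2 * x
  invFun x := 4 * x
  left_inv := by decide
  right_inv := by decide

/-- An elation of the Fano plane, of order two, that is not an affine map modulo `7`. -/
def fanoElation : Equiv.Perm (Fin 7) := Equiv.swap 0 2 * Equiv.swap 3 4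

/-- A permutation that sends lines to lines preserves the non-collinear triples. -/
theorem isFanoTriangle_map_iff {σ : Equiv.Perm (Fin 7)}
    (hσ : ∀ i : Fin 7, ∃ j : Fin 7,
      ({i, i + 1, i + 3} : Finset (Fin 7)).map σ.toEmbedding = {j, j + 1, j + 3})
    (s : Finset (Fin 7)) : IsFanoTriangle s ↔ IsFanoTriangle (s.map σ.toEmbedding) := by
  choose g hg using hσ
  have hline : ∀ i j : Fin 7, ({i, i + 1, i + 3} : Finset (Fin 7)) = {j, j + 1, j + 3} → i = j := by
    decide
  have hinj : Function.Injective g := fun i j hij =>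
    hline i j (Finset.map_injective σ.toEmbedding (by rw [hg, hg, hij]))
  have hsurj := Finite.surjective_of_injective hinj
  unfold IsFanoTriangle
  rw [Finset.card_map]
  refine and_congr_right fun _ => ⟨fun h i hi => ?_, fun h i hi => h (g i) (by rw [hi, hg])⟩
  obtain ⟨j, rfl⟩ := hsurj i
  exact h j (Finset.map_injective σ.toEmbedding (hi.trans (hg j).symm))

/-- The affine maps modulo `7` generated by `x ↦ x + 1` and `x ↦ 2x` have two orbits on the
vertices, one of them that of `{3, 5, 6}`, and the elation joins these. The map `x ↦ 2x` fixes
`{3, 5, 6}` and is transitive on its neighbours. -/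
theorem coxeterGraph_arcTransitive (d e : coxeterGraph.Dart) :
    ∃ φ : coxeterGraph ≃g coxeterGraph, φ d.fst = e.fst ∧ φ d.snd = e.snd := by
  have hφ : ∀ (i : Fin 7) (j : Fin 3) (k : Fin 2), ∃ φ : coxeterGraph ≃g coxeterGraph, ∀ s,
      (φ s).1 = s.1.map
        (fanoElation ^ (k : ℕ) * double7 ^ (j : ℕ) * shift 7 ^ (i : ℕ)).toEmbedding := by
    intro i j k
    refine exists_iso_map (X := coxeterGraph) (fun _ _ => Iff.rfl) _ (isFanoTriangle_map_iff ?_)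
    revert i j k
    decide +kernel
  refine exists_iso_dart_of_base ⟨{3, 5, 6}, by decide⟩ ⟨{0, 1, 2}, by decide⟩ (fun s => ?_)
    (fun t ht => ?_) d e
  · have h : ∀ s : {s : Finset (Fin 7) // IsFanoTriangle s},
        ∃ (i : Fin 7) (j : Fin 3) (k : Fin 2), s.1.map
          (fanoElation ^ (k : ℕ) * double7 ^ (j : ℕ) * shift 7 ^ (i : ℕ)).toEmbedding =
            {3, 5, 6} := by
      decide +kernel
    obtain ⟨i, j, k, h⟩ := h s
    obtain ⟨φ, hφ⟩ := hφ i j k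
    exact ⟨φ, Subtype.ext ((hφ s).trans h)⟩
  · have h : ∀ t : {s : Finset (Fin 7) // IsFanoTriangle s}, Disjoint {3, 5, 6} t.1 →
        ∃ j : Fin 3,
          ({3, 5, 6} : Finset (Fin 7)).map (fanoElation ^ ((0 : Fin 2) : ℕ) * double7 ^ (j : ℕ) *
            shift 7 ^ ((0 : Fin 7) : ℕ)).toEmbedding = {3, 5, 6} ∧
          t.1.map (fanoElation ^ ((0 : Fin 2) : ℕ) * double7 ^ (j : ℕ) *
            shift 7 ^ ((0 : Fin 7) : ℕ)).toEmbedding = {0, 1, 2} := by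
      decide +kernel
    obtain ⟨j, h1, h2⟩ := h t ht
    obtain ⟨φ, hφ⟩ := hφ 0 j 0
    exact ⟨φ, Subtype.ext ((hφ _).trans h1), Subtype.ext ((hφ t).trans h2)⟩

end SimpleGraph

theorem mainTheorem6 :
    (∀ m : ℕ, 1 ≤ m →
      ((SimpleGraph.petersenGraph.arcCliqueGraph m).Connected ∧
        (SimpleGraph.petersenGraph.arcCliqueGraph m).IsRegularOfDegree (3 * m) ∧
        Nat.card (SimpleGraph.petersenGraph.MultiArc m) = 30 * m ∧
        (SimpleGraph.petersenGraph.arcCliqueGraph m).IsVertexTransitive ∧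
        ¬ (SimpleGraph.petersenGraph.arcCliqueGraph m).HasHamiltonDecomposition (3 * m)) ∧
      ((SimpleGraph.coxeterGraph.arcCliqueGraph m).Connected ∧
        (SimpleGraph.coxeterGraph.arcCliqueGraph m).IsRegularOfDegree (3 * m) ∧
        Nat.card (SimpleGraph.coxeterGraph.MultiArc m) = 84 * m ∧
        (SimpleGraph.coxeterGraph.arcCliqueGraph m).IsVertexTransitive ∧
        ¬ (SimpleGraph.coxeterGraph.arcCliqueGraph m).HasHamiltonDecomposition (3 * m))) ∧
    (∀ N : ℕ, ∃ k : ℕ, N ≤ k ∧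
      ∃ (V : Type) (_ : Fintype V) (_ : DecidableEq V) (X : SimpleGraph V)
        (_ : DecidableRel X.Adj),
        X.Connected ∧ X.IsRegularOfDegree k ∧ X.IsVertexTransitive ∧
          ¬ X.HasHamiltonDecomposition k) := by

  have hF10 : Nat.card {s : Finset (Fin 5) // s.card = 2} = 10 := by
    rw [Nat.card_eq_fintype_card]
    decide +kernel
  have hF28 : Nat.card {s : Finset (Fin 7) // SimpleGraph.IsFanoTriangle s} = 28 := by
    rw [Nat.card_eq_fintype_card]
    decide +kernel
  have h10 := fun m (hm : 1 ≤ m) => SimpleGraph.arcCliqueGraph_properties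
    SimpleGraph.petersenGraph_connected SimpleGraph.petersenGraph_isRegularOfDegree
    SimpleGraph.petersenGraph_arcTransitive (by rw [hF10]; norm_num)
    (fun _ => SimpleGraph.petersenGraph_not_isSpanningCycle) hm
  have h28 := fun m (hm : 1 ≤ m) => SimpleGraph.arcCliqueGraph_properties
    SimpleGraph.coxeterGraph_connected SimpleGraph.coxeterGraph_isRegularOfDegree
    SimpleGraph.coxeterGraph_arcTransitive (lt_of_lt_of_eq (by norm_num) hF28.symm)
    (fun _ => SimpleGraph.coxeterGraph_not_isSpanningCycle) hm
  refine ⟨fun m hm => ⟨?_, ?_⟩, fun N => ?_⟩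
  · obtain ⟨h1, h2, h3, h4, h5⟩ := h10 m hm
    exact ⟨h1, h2, h3.trans (by rw [hF10]), h4, h5⟩
  · obtain ⟨h1, h2, h3, h4, h5⟩ := h28 m hm
    exact ⟨h1, h2, h3.trans (congrArg (· * 3 * m) hF28), h4, h5⟩
  · obtain ⟨h1, h2, -, h4, h5⟩ := h10 (N + 1) (Nat.le_add_left 1 N)
    exact ⟨3 * (N + 1), by omega, _, inferInstance, inferInstance, _, inferInstance, h1, h2, h4, h5⟩
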